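/- There is a constant $C$ such that for every finite set $E$, with $n=|E|$, there is a quantum algorithm that makes at most $C\,n^{3/2}$ queries to an independence oracle and that, for every matroid $M=(E,\mathcal I)$ on the ground set $E$, decides with bounded error $1/3$ whether $M$ is connected: if $M$ is connected it answers YES with probability at least $2/3$, and if $M$ is not connected it answers NO with probability at least $2/3$. Here $M$, with rank function $r$, is called connected if $r(A)+r(E\setminus A)>r(E)$ for every nonempty proper subset $A$ of $E$. The independence oracle of $M$ is the function $O_M:2^E\to\{0,1\}$ with $O_M(S)=1$ if and only if $S\in\mathcal I$; it is queried through the unitary $|S\rangle|b\rangle|w\rangle\mapsto|S\rangle|b\oplus O_M(S)\rangle|w\rangle$, where $w$ is the content of a finite workspace. A quantum algorithm with $T$ queries consists of unitaries $U_0,\dots,U_T$ that do not depend on $M$: it prepares the state $U_TO_M\cdots O_MU_1O_MU_0|\mathrm{start}\rangle$ from a fixed basis state $|\mathrm{start}\rangle$, measures it in the computational basis, and returns an answer, YES or NO, determined by the outcome. -/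

import Mathlib

open scoped Matrix

/-- A matroid with rank function `r` is connected if `r(A) + r(E - A) > r(E)` for every
nonempty proper subset `A` of its ground set `E`. -/
def Matroid.IsConnected {α : Type*} (M : Matroid α) : Prop :=
  ∀ A : Set α, A.Nonempty → A ⊂ M.E → M.eRk M.E < M.eRk A + M.eRk (M.E \ A)

open Classical in
/-- The independence oracle of a matroid, as a Boolean function on the subsets of a finite set. -/
noncomputable def Matroid.indepOracle {α : Type*} (M : Matroid α) (S : Finset α) : Bool :=
  decide (M.Indep (S : Set α))

/-- Labels of the computational basis states `|i, y, w⟩`: a query index `i`, the answer qubit `y`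
and the content `w` of the workspace. -/
abbrev QueryBasis (I W : Type*) := I × Bool × W

/-- The query unitary `O_x : |i, y, w⟩ ↦ |i, y ⊕ x_i, w⟩` of an input `x`. -/
def queryMatrix {I W : Type*} [DecidableEq I] [DecidableEq W] (x : I → Bool) :
    Matrix (QueryBasis I W) (QueryBasis I W) ℂ :=
  Matrix.of fun a b => if a = (b.1, xor b.2.1 (x b.1), b.2.2) then 1 else 0

/-- A quantum decision tree (quantum query algorithm) for inputs `x : I → Bool`. It is made of
a number of queries `T`, a finite workspace, an initial basis state, unitaries `U_0, …, U_T` that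
do not depend on the input (the entries of the sequence `U` after the `T`-th one are never applied),
and a Boolean output assigned to each outcome of the final computational basis measurement. -/
structure QuantumDecisionTree (I : Type*) [Fintype I] [DecidableEq I] where
  /-- the number of queries -/
  T : ℕ
  /-- the labels of the basis states of the workspace -/
  W : Type
  [fintypeW : Fintype W]
  [decidableEqW : DecidableEq W]
  /-- the initial basis state -/
  start : QueryBasis I W
  /-- the unitary operations applied between the queries -/
  U : ℕ → Matrix.unitaryGroup (QueryBasis I W) ℂ
  /-- the result that is returned for each measurement outcome -/
  out : QueryBasis I W → Bool

namespace QuantumDecisionTree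

attribute [instance] fintypeW decidableEqW

variable {I : Type*} [Fintype I] [DecidableEq I]

/-- The state `U_k O_x ⋯ O_x U_1 O_x U_0 |start⟩` after `k` queries on input `x`. -/
def state (A : QuantumDecisionTree I) (x : I → Bool) : ℕ → QueryBasis I A.W → ℂ
  | 0 => (A.U 0).1 *ᵥ Pi.single A.start 1
  | k + 1 => (A.U (k + 1)).1 *ᵥ (queryMatrix x *ᵥ A.state x k)

/-- The probability that measuring the final state on input `x` yields the result `b`. -/
noncomputable def prob (A : QuantumDecisionTree I) (x : I → Bool) (b : Bool) : ℝ :=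
  ∑ z with A.out z = b, ‖A.state x A.T z‖ ^ 2

end QuantumDecisionTree

/-! ### Unitary matrices -/

namespace Matrix

variable {n : Type*} [Fintype n] [DecidableEq n]

/-! Fix a base `B` and join `b ∈ B` to `e ∉ B` when `B - b + e` is independent. The matroid is
connected iff this exchange graph is. If no edge leaves `X`, fundamental circuits give `r(X) ≤ |B ∩
X|` and `r(E \ X) ≤ |B \ X|`, with sum `r(E)`; conversely, an edge leaving `X` makes the rank sum
exceed `r(E)` (`Matroid.IsConnected.exists_exchange`,
`Matroid.IsBase.mem_iff_mem_of_eRk_add_eRk_le`). The greedy algorithm finds a base with `n` queries.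

To test the graph, keep a partition of `E`, at first into singletons, and use Grover search for an
edge between different classes, which are then merged. While `k ≥ 2` classes remain, a connected
graph has at least `k/2` such edges among at most `n²` pairs, so a search costs `O(n/√k)`, and these
costs sum to `O(n^{3/2})`. Error reduction costs no logarithm: each phase has constantly many
rounds, and the potential `2^k - 2`, which every merge at least halves, bounds the total failure
probability (`runRounds_phases_le`). Each edge found is verified by a query, so no merge crosses a
separator and a disconnected matroid is never accepted.

Adaptivity is handled by deferred measurement: `Realizable` describes the outcome distribution by
its expectation functional, and `Realizable.bind` composes algorithms while adding their query
counts. -/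

theorem submatrix_mem_unitaryGroup {m : Type*} [Fintype m] [DecidableEq m] (e : m ≃ n)
    {M : Matrix n n ℂ} (hM : M ∈ unitaryGroup n ℂ) : M.submatrix e e ∈ unitaryGroup m ℂ := by
  rw [mem_unitaryGroup_iff] at hM ⊢
  rw [star_eq_conjTranspose, conjTranspose_submatrix, submatrix_mul_equiv,
    ← star_eq_conjTranspose, hM, submatrix_one_equiv]

theorem permMatrix_mem_unitaryGroup (σ : Equiv.Perm n) :
    σ.permMatrix ℂ ∈ unitaryGroup n ℂ := by
  rw [mem_unitaryGroup_iff, star_eq_conjTranspose, conjTranspose_permMatrix,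
    ← permMatrix_mul]
  simp

theorem fromBlocks_mem_unitaryGroup {m : Type*} [Fintype m] [DecidableEq m]
    {M : Matrix m m ℂ} {N : Matrix n n ℂ} (hM : M ∈ unitaryGroup m ℂ)
    (hN : N ∈ unitaryGroup n ℂ) : fromBlocks M 0 0 N ∈ unitaryGroup (m ⊕ n) ℂ := by
  rw [mem_unitaryGroup_iff, star_eq_conjTranspose] at *
  rw [fromBlocks_conjTranspose, fromBlocks_multiply]
  simp [hM, hN, fromBlocks_one]

theorem blockDiagonal'_mem_unitaryGroup {K : Type*} [Fintype K] [DecidableEq K] {m : K → Type*}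
    [∀ k, Fintype (m k)] [∀ k, DecidableEq (m k)] (M : ∀ k, unitaryGroup (m k) ℂ) :
    blockDiagonal' (fun k => (M k).1) ∈ unitaryGroup (Σ k, m k) ℂ := by
  rw [mem_unitaryGroup_iff, star_eq_conjTranspose, blockDiagonal'_conjTranspose,
    ← blockDiagonal'_mul]
  have h : ∀ k, (M k).1 * (M k).1ᴴ = 1 := fun k => mem_unitaryGroup_iff.1 (M k).2
  simp only [h]
  exact blockDiagonal'_one

theorem sum_norm_sq_mulVec {M : Matrix n n ℂ} (hM : M ∈ unitaryGroup n ℂ) (v : n → ℂ) :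
    ∑ i, ‖(M *ᵥ v) i‖ ^ 2 = ∑ i, ‖v i‖ ^ 2 := by
  have key : ∀ w : n → ℂ, ((∑ i, ‖w i‖ ^ 2 : ℝ) : ℂ) = star w ⬝ᵥ w := by
    intro w
    simp [dotProduct, Complex.conj_mul']
  have h : star (M *ᵥ v) ⬝ᵥ (M *ᵥ v) = star v ⬝ᵥ v := by
    rw [star_mulVec, dotProduct_mulVec, vecMul_vecMul, ← star_eq_conjTranspose,
      mem_unitaryGroup_iff'.1 hM, vecMul_one]
  exact_mod_cast (key _).trans (h.trans (key _).symm)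

end Matrix

/-! ### The query matrix and controlled unitaries -/

section query

set_option linter.unusedSectionVars false

variable {I : Type*} [Fintype I] [DecidableEq I]

theorem queryMatrix_mulVec {W : Type*} [Fintype W] [DecidableEq W] (x : I → Bool)
    (ψ : QueryBasis I W → ℂ) :
    queryMatrix x *ᵥ ψ = fun z => ψ (z.1, xor z.2.1 (x z.1), z.2.2) := by
  ext z
  rw [Matrix.mulVec, dotProduct, Finset.sum_eq_single (z.1, xor z.2.1 (x z.1), z.2.2)]
  · simp [queryMatrix]
  · rintro ⟨i, y, w⟩ - hb
    simp only [queryMatrix, Matrix.of_apply, ite_mul, one_mul, zero_mul, ite_eq_right_iff]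
    rintro rfl
    simp at hb
  · simp

theorem sum_norm_sq_queryMatrix_mulVec {W : Type*} [Fintype W] [DecidableEq W] (x : I → Bool)
    (ψ : QueryBasis I W → ℂ) :
    ∑ z, ‖(queryMatrix x *ᵥ ψ) z‖ ^ 2 = ∑ z, ‖ψ z‖ ^ 2 := by
  have h : Function.Involutive
      (fun z : QueryBasis I W => ((z.1, xor z.2.1 (x z.1), z.2.2) : QueryBasis I W)) := by
    rintro ⟨i, y, w⟩
    simp
  rw [queryMatrix_mulVec]
  exact Equiv.sum_comp h.toPerm (fun z => ‖ψ z‖ ^ 2)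

/-- The basis states of a workspace with a sum of memories. -/
def queryBasisEquiv (I W : Type*) {K : Type*} (V : K → Type*) :
    QueryBasis I (W ⊕ Σ k, V k) ≃ QueryBasis I W ⊕ Σ k, QueryBasis I (V k) where
  toFun z := match z with
    | (i, y, .inl w) => .inl (i, y, w)
    | (i, y, .inr ⟨k, v⟩) => .inr ⟨k, (i, y, v)⟩
  invFun z := match z with
    | .inl (i, y, w) => (i, y, .inl w)
    | .inr ⟨k, (i, y, v)⟩ => (i, y, .inr ⟨k, v⟩)
  left_inv := by rintro ⟨i, y, w | ⟨k, v⟩⟩ <;> rfl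
  right_inv := by rintro (⟨i, y, w⟩ | ⟨k, i, y, v⟩) <;> rfl

variable {W : Type*} [Fintype W] [DecidableEq W] {K : Type*} [Fintype K] [DecidableEq K]
  {V : K → Type*} [∀ k, Fintype (V k)] [∀ k, DecidableEq (V k)]

/-- A state that lives on the first summand of the workspace. -/
def inlState (α : QueryBasis I W → ℂ) : QueryBasis I (W ⊕ Σ k, V k) → ℂ :=
  Sum.elim α 0 ∘ queryBasisEquiv I W V

/-- A state that lives on the second summand of the workspace. -/
def inrState (β : ∀ k, QueryBasis I (V k) → ℂ) : QueryBasis I (W ⊕ Σ k, V k) → ℂ :=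
  Sum.elim 0 (fun p => β p.1 p.2) ∘ queryBasisEquiv I W V

/-- The unitary that acts on the first summand of the workspace by `U₁` and on the second one by
`U₂`, controlled by the index of the memory. -/
def controlledUnitary (U₁ : Matrix.unitaryGroup (QueryBasis I W) ℂ)
    (U₂ : ∀ k, Matrix.unitaryGroup (QueryBasis I (V k)) ℂ) :
    Matrix.unitaryGroup (QueryBasis I (W ⊕ Σ k, V k)) ℂ :=
  ⟨_, Matrix.submatrix_mem_unitaryGroup (queryBasisEquiv I W V)
    (Matrix.fromBlocks_mem_unitaryGroup U₁.2 (Matrix.blockDiagonal'_mem_unitaryGroup U₂))⟩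

theorem controlledUnitary_mulVec_inlState (U₁ : Matrix.unitaryGroup (QueryBasis I W) ℂ)
    (U₂ : ∀ k, Matrix.unitaryGroup (QueryBasis I (V k)) ℂ) (α : QueryBasis I W → ℂ) :
    (controlledUnitary U₁ U₂).1 *ᵥ inlState α = inlState (U₁.1 *ᵥ α) := by
  rw [controlledUnitary, inlState, Matrix.submatrix_mulVec_equiv, Function.comp_assoc,
    Equiv.self_comp_symm, Function.comp_id, Matrix.fromBlocks_mulVec, inlState]
  congr 1
  ext (z | z) <;> simp

theorem controlledUnitary_mulVec_inrState (U₁ : Matrix.unitaryGroup (QueryBasis I W) ℂ)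
    (U₂ : ∀ k, Matrix.unitaryGroup (QueryBasis I (V k)) ℂ)
    (β : ∀ k, QueryBasis I (V k) → ℂ) :
    (controlledUnitary U₁ U₂).1 *ᵥ (inrState β : QueryBasis I (W ⊕ Σ k, V k) → ℂ) =
      inrState fun k => (U₂ k).1 *ᵥ β k := by
  rw [controlledUnitary, inrState, Matrix.submatrix_mulVec_equiv, Function.comp_assoc,
    Equiv.self_comp_symm, Function.comp_id, Matrix.fromBlocks_mulVec, inrState]
  congr 1
  ext (z | ⟨k, z⟩)
  · simp
  · simp only [Sum.elim_inr, Matrix.zero_mulVec, zero_add, Matrix.mulVec, dotProduct,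
      Function.comp_apply, Fintype.sum_sigma]
    rw [Finset.sum_eq_single k]
    · simp [Matrix.blockDiagonal'_apply_eq]
    · intro k' _ hk
      simp [Matrix.blockDiagonal'_apply_ne _ _ _ hk.symm]
    · simp

theorem queryMatrix_mulVec_inlState (x : I → Bool) (α : QueryBasis I W → ℂ) :
    queryMatrix x *ᵥ (inlState α : QueryBasis I (W ⊕ Σ k, V k) → ℂ) =
      inlState (queryMatrix x *ᵥ α) := by
  simp only [queryMatrix_mulVec]
  ext ⟨i, y, w | ⟨k, v⟩⟩ <;> rfl

theorem queryMatrix_mulVec_inrState (x : I → Bool) (β : ∀ k, QueryBasis I (V k) → ℂ) :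
    queryMatrix x *ᵥ (inrState β : QueryBasis I (W ⊕ Σ k, V k) → ℂ) =
      inrState fun k => queryMatrix x *ᵥ β k := by
  simp only [queryMatrix_mulVec]
  ext ⟨i, y, w | ⟨k, v⟩⟩ <;> rfl

/-- The permutation that stores the first register in the memory and prepares the basis states
`s k` on the second summand. -/
def storePerm (κ : QueryBasis I W ≃ K) (s : ∀ k, QueryBasis I (V k)) :
    Equiv.Perm (QueryBasis I W ⊕ Σ k, QueryBasis I (V k)) :=
  Function.Involutive.toPerm
    -- Swapping each basis state `a` with the fresh start state in memory `κ a`, and fixing all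
    -- else, is an involution, hence a permutation.
    (fun z => match z with
      | .inl a => .inr ⟨κ a, s (κ a)⟩
      | .inr p => if p.2 = s p.1 then .inl (κ.symm p.1) else .inr p) <| by
    rintro (a | ⟨k, z⟩)
    · simp
    · by_cases h : z = s k
      · subst h
        simp [congr_arg_heq s (κ.apply_symm_apply k)]
      · simp [h]

theorem storePerm_inr (κ : QueryBasis I W ≃ K) (s : ∀ k, QueryBasis I (V k))
    (p : Σ k, QueryBasis I (V k)) :
    storePerm κ s (.inr p) = if p.2 = s p.1 then .inl (κ.symm p.1) else .inr p := rfl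

/-- The unitary matrix of `storePerm`. -/
noncomputable def storeUnitary (κ : QueryBasis I W ≃ K) (s : ∀ k, QueryBasis I (V k)) :
    Matrix.unitaryGroup (QueryBasis I (W ⊕ Σ k, V k)) ℂ :=
  ⟨_, Matrix.submatrix_mem_unitaryGroup (queryBasisEquiv I W V)
    (Matrix.permMatrix_mem_unitaryGroup (storePerm κ s))⟩

theorem storeUnitary_mulVec_inlState (κ : QueryBasis I W ≃ K) (s : ∀ k, QueryBasis I (V k))
    (α : QueryBasis I W → ℂ) :
    (storeUnitary κ s).1 *ᵥ inlState α =
      inrState fun k => α (κ.symm k) • Pi.single (s k) (1 : ℂ) := by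
  rw [storeUnitary, inlState, Matrix.submatrix_mulVec_equiv, Function.comp_assoc,
    Equiv.self_comp_symm, Function.comp_id, Matrix.permMatrix_mulVec, inrState]
  congr 1
  ext (z | ⟨k, z⟩)
  · rfl
  · by_cases h : z = s k
    · subst h
      simp [storePerm_inr]
    · simp [storePerm_inr, h]

/-- Branches with different memory indices occupy disjoint sets of basis states, so they do not
interfere. -/
theorem sum_norm_sq_inrState (β : ∀ k, QueryBasis I (V k) → ℂ)
    (f : QueryBasis I W ⊕ (Σ k, QueryBasis I (V k)) → ℝ) :
    ∑ z, ‖(inrState β : QueryBasis I (W ⊕ Σ k, V k) → ℂ) z‖ ^ 2 * f (queryBasisEquiv I W V z) =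
      ∑ k, ∑ z, ‖β k z‖ ^ 2 * f (.inr ⟨k, z⟩) := by
  rw [← Equiv.sum_comp (queryBasisEquiv I W V).symm]
  simp [inrState, Fintype.sum_sigma]

end query

/-! ### Deferred measurement and composition of query algorithms -/

namespace QuantumDecisionTree

set_option linter.unusedSectionVars false

variable {I : Type*} [Fintype I] [DecidableEq I]

theorem sum_norm_sq_state (A : QuantumDecisionTree I) (x : I → Bool) (k : ℕ) :
    ∑ z, ‖A.state x k z‖ ^ 2 = 1 := by
  induction k with
  | zero =>
    rw [state, Matrix.sum_norm_sq_mulVec (A.U 0).2, Finset.sum_eq_single A.start]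
    · simp
    · intro b _ hb
      simp [hb]
    · simp
  | succ k ih =>
    rw [state, Matrix.sum_norm_sq_mulVec (A.U (k + 1)).2, sum_norm_sq_queryMatrix_mulVec, ih]

/-- The expectation of `f` at the outcome `out z` of the final measurement on input `x`. -/
noncomputable def expect {O : Type*} (A : QuantumDecisionTree I) (out : QueryBasis I A.W → O)
    (x : I → Bool) (f : O → ℝ) : ℝ :=
  ∑ z, ‖A.state x A.T z‖ ^ 2 * f (out z)

theorem prob_eq_expect (A : QuantumDecisionTree I) (x : I → Bool) (b : Bool) :
    A.prob x b = A.expect A.out x fun o => if o = b then 1 else 0 := by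
  simp [prob, expect, Finset.sum_filter]

/-- The state `U_k O_x ⋯ O_x U_1 O_x U_0 |s⟩`. -/
def evolve {W : Type*} [Fintype W] [DecidableEq W]
    (U : ℕ → Matrix.unitaryGroup (QueryBasis I W) ℂ) (s : QueryBasis I W) (x : I → Bool) :
    ℕ → QueryBasis I W → ℂ
  | 0 => (U 0).1 *ᵥ Pi.single s 1
  | k + 1 => (U (k + 1)).1 *ᵥ (queryMatrix x *ᵥ evolve U s x k)

theorem state_eq_evolve (A : QuantumDecisionTree I) (x : I → Bool) (k : ℕ) :
    A.state x k = evolve A.U A.start x k := by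
  induction k with
  | zero => rfl
  | succ k ih => rw [state, ih, evolve]

section bind

variable {W : Type*} [Fintype W] [DecidableEq W] {K : Type*} [Fintype K] [DecidableEq K]
  {V : K → Type*} [∀ k, Fintype (V k)] [∀ k, DecidableEq (V k)]
  (κ : QueryBasis I W ≃ K) (T : ℕ) (U₁ : ℕ → Matrix.unitaryGroup (QueryBasis I W) ℂ)
  (U₂ : ∀ k, ℕ → Matrix.unitaryGroup (QueryBasis I (V k)) ℂ) (s : QueryBasis I W)
  (s₂ : ∀ k, QueryBasis I (V k))

/-- The unitaries that run `U₁` with `T` queries and then `U₂ k`, where `k` is the basis state of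
all registers after the first run. -/
noncomputable def bindUnitary (t : ℕ) : Matrix.unitaryGroup (QueryBasis I (W ⊕ Σ k, V k)) ℂ :=
  if t < T then controlledUnitary (U₁ t) 1
  else if t = T then
    -- The end of the first run, the handover and the start of the second run form one unitary, so
    -- the handover costs no query.
    controlledUnitary 1 (fun k => U₂ k 0) * storeUnitary κ s₂ * controlledUnitary (U₁ t) 1
  else controlledUnitary 1 (fun k => U₂ k (t - T))

/-- The initial state on the first summand of the workspace. -/
def bindStart : QueryBasis I (W ⊕ Σ k, V k) := (s.1, s.2.1, .inl s.2.2)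

theorem single_bindStart :
    Pi.single (bindStart s : QueryBasis I (W ⊕ Σ k, V k)) (1 : ℂ) =
      inlState (Pi.single s 1) := by
  obtain ⟨i', y', w'⟩ := s
  ext ⟨i, y, w | ⟨k, v⟩⟩ <;> simp [inlState, queryBasisEquiv, Pi.single_apply, bindStart]

theorem evolve_bindUnitary_of_lt (x : I → Bool) {t : ℕ} (ht : t < T) :
    evolve (bindUnitary κ T U₁ U₂ s₂) (bindStart s) x t = inlState (evolve U₁ s x t) := by
  induction t with
  | zero =>
    rw [evolve, single_bindStart, bindUnitary, if_pos ht, controlledUnitary_mulVec_inlState, evolve]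
  | succ t ih =>
    rw [evolve, ih (by omega), bindUnitary, if_pos ht, queryMatrix_mulVec_inlState,
      controlledUnitary_mulVec_inlState, evolve]

theorem bindUnitary_self_mulVec (α : QueryBasis I W → ℂ) :
    (bindUnitary κ T U₁ U₂ s₂ T).1 *ᵥ inlState α =
      inrState fun k => ((U₁ T).1 *ᵥ α) (κ.symm k) • ((U₂ k 0).1 *ᵥ Pi.single (s₂ k) 1) := by
  rw [bindUnitary, if_neg (lt_irrefl T), if_pos rfl, Submonoid.coe_mul, Submonoid.coe_mul,
    ← Matrix.mulVec_mulVec, ← Matrix.mulVec_mulVec, controlledUnitary_mulVec_inlState,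
    storeUnitary_mulVec_inlState, controlledUnitary_mulVec_inrState]
  simp only [Matrix.mulVec_smul]

theorem evolve_bindUnitary_add (x : I → Bool) (t : ℕ) :
    evolve (bindUnitary κ T U₁ U₂ s₂) (bindStart s) x (T + t) =
      inrState fun k => evolve U₁ s x T (κ.symm k) • evolve (U₂ k) (s₂ k) x t := by
  induction t with
  | zero =>
    rcases T with _ | T
    · rw [add_zero, evolve, single_bindStart, bindUnitary_self_mulVec]
      rfl
    · rw [add_zero, evolve, evolve_bindUnitary_of_lt κ (T + 1) U₁ U₂ s s₂ x (Nat.lt_succ_self T),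
        queryMatrix_mulVec_inlState, bindUnitary_self_mulVec]
      rfl
  | succ t ih =>
    rw [← add_assoc, evolve, ih, queryMatrix_mulVec_inrState, bindUnitary, if_neg (by omega),
      if_neg (by omega), controlledUnitary_mulVec_inrState, show T + t + 1 - T = t + 1 by omega]
    simp only [Matrix.mulVec_smul, evolve]

end bind

/-- `A` followed by the trees `B k`, where `k` is the outcome of the measurement of all registers
after `A`. -/
noncomputable def bind (A : QuantumDecisionTree I) {K : Type} [Fintype K] [DecidableEq K]
    (κ : QueryBasis I A.W ≃ K) (T : ℕ) (B : K → QuantumDecisionTree I) :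
    QuantumDecisionTree I where
  T := A.T + T
  W := A.W ⊕ Σ k, (B k).W
  start := bindStart A.start
  U := bindUnitary κ A.T A.U (fun k => (B k).U) fun k => (B k).start
  out _ := true

/-- After the handover the memory index is only a control, so the final distribution is the mixture
obtained by measuring after `A`. The value of the output map on the first summand is immaterial,
since no amplitude is left there. -/
theorem expect_bind (A : QuantumDecisionTree I) {K : Type} [Fintype K] [DecidableEq K]
    (κ : QueryBasis I A.W ≃ K) (T : ℕ) (B : K → QuantumDecisionTree I)
    (hB : ∀ k, (B k).T = T) {O : Type*} (outB : ∀ k, QueryBasis I (B k).W → O)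
    (x : I → Bool) (f : O → ℝ) :
    (A.bind κ T B).expect (fun z => Sum.elim (fun a => outB (κ a) (B (κ a)).start)
        (fun p : Σ k, QueryBasis I (B k).W => outB p.1 p.2)
        (queryBasisEquiv I A.W (fun k => (B k).W) z)) x f =
      ∑ a, ‖A.state x A.T a‖ ^ 2 * (B (κ a)).expect (outB (κ a)) x f := by
  have h : (A.bind κ T B).state x (A.bind κ T B).T =
      inrState fun k => evolve A.U A.start x A.T (κ.symm k) • evolve (B k).U (B k).start x T :=
    (state_eq_evolve _ _ _).trans (evolve_bindUnitary_add _ _ _ _ _ _ x T)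
  rw [expect, h]
  refine (sum_norm_sq_inrState (I := I) (W := A.W) _ fun z =>
    f (Sum.elim (fun a => outB (κ a) (B (κ a)).start)
      (fun p : Σ k, QueryBasis I (B k).W => outB p.1 p.2) z)).trans ?_
  rw [← Equiv.sum_comp κ]
  refine Finset.sum_congr rfl fun a _ => ?_
  rw [expect, Finset.mul_sum, hB]
  refine Finset.sum_congr rfl fun z _ => ?_
  simp [mul_pow, mul_assoc, state_eq_evolve]

/-- `Realizable T E` says that `E x f` is the expectation of `f` at the outcome of a quantum
decision tree with `T` queries on the input `x`. -/
def Realizable {O : Type*} (T : ℕ) (E : (I → Bool) → (O → ℝ) → ℝ) : Prop :=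
  ∃ (A : QuantumDecisionTree I) (out : QueryBasis I A.W → O),
    A.T = T ∧ ∀ x f, A.expect out x f = E x f

namespace Realizable

variable {O O' : Type*} {T T' : ℕ} {E : (I → Bool) → (O → ℝ) → ℝ}

theorem mono (h : Realizable T E) (x : I → Bool) {f g : O → ℝ} (hfg : ∀ o, f o ≤ g o) :
    E x f ≤ E x g := by
  obtain ⟨A, out, -, h⟩ := h
  rw [← h, ← h]
  exact Finset.sum_le_sum fun z _ => mul_le_mul_of_nonneg_left (hfg _) (sq_nonneg _)

theorem mul_add_const (h : Realizable T E) (x : I → Bool) (f : O → ℝ) (a b : ℝ) :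
    E x (fun o => a * f o + b) = a * E x f + b := by
  obtain ⟨A, out, -, h⟩ := h
  rw [← h, ← h, expect, expect]
  have := A.sum_norm_sq_state x A.T
  simp only [mul_add, Finset.sum_add_distrib, ← Finset.sum_mul, this, one_mul, Finset.mul_sum]
  congr 1
  exact Finset.sum_congr rfl fun z _ => by ring

theorem const (h : Realizable T E) (x : I → Bool) (b : ℝ) : E x (fun _ => b) = b := by
  simpa using h.mul_add_const x (fun _ => 0) 0 b

theorem bind (h : Realizable T E) {E' : O → (I → Bool) → (O' → ℝ) → ℝ}
    (h' : ∀ o, Realizable T' (E' o)) :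
    Realizable (T + T') fun x f => E x fun o => E' o x f := by
  obtain ⟨A, out, rfl, hA⟩ := h
  choose B outB hBT hB using h'
  -- Workspaces lie in `Type`, whereas the basis states lie in the universe of `I`; they are
  -- therefore stored as numbers.
  let κ := Fintype.equivFin (QueryBasis I A.W)
  refine ⟨A.bind κ T' fun k => B (out (κ.symm k)), _, rfl, fun x f =>
    (expect_bind A κ T' _ (fun k => hBT _) (fun k => outB (out (κ.symm k))) x f).trans
      (Eq.trans ?_ (hA x fun o => E' o x f))⟩
  refine Finset.sum_congr rfl fun a _ => ?_
  simp only [hB, Equiv.symm_apply_apply]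

theorem idle [Nonempty I] (T : ℕ) (o : O) :
    Realizable T fun (_ : I → Bool) (f : O → ℝ) => f o := by
  refine ⟨⟨T, Unit, (Classical.arbitrary I, false, ()), fun _ => 1, fun _ => true⟩,
    fun _ => o, rfl, fun x f => ?_⟩
  rw [expect, ← Finset.sum_mul, sum_norm_sq_state, one_mul]

theorem of_le [Nonempty I] (h : Realizable T E) (hT : T ≤ T') : Realizable T' E := by
  obtain ⟨k, rfl⟩ := Nat.exists_eq_add_of_le hT
  exact h.bind fun o => idle k o

theorem map [Nonempty I] (h : Realizable T E) (g : O → O') :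
    Realizable T fun x f => E x fun o => f (g o) :=
  h.bind (T' := 0) fun o => idle 0 (g o)

theorem query (i : I) : Realizable 1 fun (x : I → Bool) (f : Bool → ℝ) => f (x i) := by
  refine ⟨⟨1, Unit, (i, false, ()), fun _ => 1, fun _ => true⟩, fun z => z.2.1, rfl,
    fun x f => ?_⟩
  have h : ∀ z : QueryBasis I Unit, QuantumDecisionTree.state
      ⟨1, Unit, (i, false, ()), fun _ => 1, fun _ => true⟩ x 1 z =
        if z = (i, x i, ()) then 1 else 0 := by
    rintro ⟨j, y, _⟩
    simp only [state, OneMemClass.coe_one, Matrix.one_mulVec, queryMatrix_mulVec, Pi.single_apply,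
      Prod.mk.injEq, and_true]
    congr 1
    by_cases hj : j = i
    · subst hj
      cases y <;> cases x j <;> simp
    · simp [hj]
  simp only [expect, h]
  rw [Finset.sum_eq_single (i, x i, ())]
  · simp
  · intro b _ hb
    simp [hb]
  · simp

end Realizable

end QuantumDecisionTree

/-! ### Householder reflections -/

namespace Matrix

variable {n : Type*} [Fintype n] [DecidableEq n]

theorem one_sub_smul_vecMulVec_mem_unitaryGroup (v : n → ℂ) (α : ℂ) (hα : star α = α)
    (h : α ^ 2 * (star v ⬝ᵥ v) = 2 * α) :
    1 - α • vecMulVec v (star v) ∈ unitaryGroup n ℂ := by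
  have h1 : vecMulVec v (star v) * vecMulVec v (star v) =
      (star v ⬝ᵥ v) • vecMulVec v (star v) := by
    rw [vecMulVec_mul_vecMulVec, vecMulVec_smul]
  have h2 : star (1 - α • vecMulVec v (star v)) = 1 - α • vecMulVec v (star v) := by
    simp [star_eq_conjTranspose, conjTranspose_vecMulVec, hα]
  rw [mem_unitaryGroup_iff, h2, sub_mul, one_mul, mul_sub, mul_one, smul_mul_smul_comm, h1,
    smul_smul, ← pow_two, h, two_mul, add_smul]
  abel

theorem one_sub_smul_vecMulVec_mulVec (v w : n → ℂ) (α : ℂ) :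
    (1 - α • vecMulVec v (star v)) *ᵥ w = w - (α * (star v ⬝ᵥ w)) • v := by
  rw [sub_mulVec, one_mulVec, smul_mulVec, vecMulVec_mulVec]
  ext i
  simp only [Pi.sub_apply, Pi.smul_apply, smul_eq_mul, op_smul_eq_smul]
  ring

open scoped ComplexOrder in
-- The Householder reflection along `e_s - u` exchanges `e_s` and `u`; over `ℂ` this requires `u s`
-- to be real.
theorem exists_unitary_mulVec_single (s : n) (u : n → ℂ) (hu : star u ⬝ᵥ u = 1)
    (hs : star (u s) = u s) :
    ∃ U : unitaryGroup n ℂ, U.1 *ᵥ Pi.single s 1 = u := by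
  set v : n → ℂ := Pi.single s 1 - u with hv
  have h1 : star v ⬝ᵥ Pi.single s 1 = 1 - u s := by
    simp [hv, hs]
  have h2 : star v ⬝ᵥ v = 2 * (1 - u s) := by
    rw [show star v ⬝ᵥ v = star v ⬝ᵥ Pi.single s 1 - star v ⬝ᵥ u by rw [← dotProduct_sub], h1]
    simp [hv, sub_dotProduct, hu]
    ring
  by_cases h : u s = 1
  · rw [h, sub_self, mul_zero, dotProduct_star_self_eq_zero] at h2
    exact ⟨1, by rw [OneMemClass.coe_one, one_mulVec, ← sub_eq_zero, ← hv, h2]⟩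
  · have h0 : 1 - u s ≠ 0 := sub_ne_zero.2 (Ne.symm h)
    refine ⟨⟨_, one_sub_smul_vecMulVec_mem_unitaryGroup v (1 - u s)⁻¹ ?_ ?_⟩, ?_⟩
    · rw [star_inv₀, star_sub, star_one, hs]
    · rw [h2]
      field_simp
    · rw [one_sub_smul_vecMulVec_mulVec, h1, inv_mul_cancel₀ h0, one_smul, hv, sub_sub_cancel]

/-- The reflection about the line spanned by a unit vector `u`. -/
def lineReflection (u : n → ℂ) (hu : star u ⬝ᵥ u = 1) : unitaryGroup n ℂ :=
  ⟨-(1 - (2 : ℂ) • vecMulVec u (star u)), by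
    have h := one_sub_smul_vecMulVec_mem_unitaryGroup u 2 (by simp) (by rw [hu]; norm_num)
    rw [mem_unitaryGroup_iff] at h ⊢
    rw [star_neg, neg_mul_neg, h]⟩

theorem lineReflection_mulVec (u : n → ℂ) (hu : star u ⬝ᵥ u = 1) (w : n → ℂ) :
    (lineReflection u hu).1 *ᵥ w = (2 * (star u ⬝ᵥ w)) • u - w := by
  rw [lineReflection, neg_mulVec, one_sub_smul_vecMulVec_mulVec, neg_sub]

end Matrix

/-! ### Grover search with an unknown number of marked items -/

namespace QuantumDecisionTree

set_option linter.unusedSectionVars false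

variable {I : Type*} [Fintype I] [DecidableEq I]

theorem Realizable.uniform [Nonempty I] (m : ℕ) (hm : 0 < m) :
    Realizable 0 fun (_ : I → Bool) (f : Fin m → ℝ) => (∑ j, f j) / m := by
  let i₀ := Classical.arbitrary I
  let w₀ : Fin m := ⟨0, hm⟩
  let u : QueryBasis I (Fin m) → ℂ := fun z =>
    if z.1 = i₀ then if z.2.1 = false then ((√m)⁻¹ : ℝ) else 0 else 0
  have hm' : (m : ℝ) ≠ 0 := by positivity
  have hu : star u ⬝ᵥ u = 1 := by
    simp only [u, dotProduct, Fintype.sum_prod_type, Pi.star_apply]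
    rw [Finset.sum_eq_single i₀ (fun b _ hb => by simp [hb]) (by simp)]
    simp only [if_true, Fintype.sum_bool, RCLike.star_def, Complex.conj_ofReal]
    simp
    norm_cast
    rw [← mul_inv, Real.mul_self_sqrt (by positivity), mul_inv_cancel₀ hm']
  obtain ⟨U, hU⟩ := Matrix.exists_unitary_mulVec_single (i₀, false, w₀) u hu (by simp [u])
  refine ⟨⟨0, Fin m, (i₀, false, w₀), fun _ => U, fun _ => true⟩, fun z => z.2.2, rfl,
    fun x f => ?_⟩
  simp only [expect, state, hU]
  simp only [u, Fintype.sum_prod_type]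
  rw [Finset.sum_eq_single i₀ (fun b _ hb => by simp [hb]) (by simp)]
  simp [← Finset.mul_sum, div_eq_inv_mul]

/-- The initial state of Grover's search over `D`. -/
noncomputable def groverStart (D : Finset I) : QueryBasis I Bool → ℂ := fun z =>
  -- The answer qubit is `|-⟩` if the workspace bit is true and `|+⟩` otherwise, so a query flips
  -- the sign only in the first case. The bit thus halves the marked fraction, to at most `1/2`.
  if z.1 ∈ D then if z.2.1 && z.2.2 then -((2 * √D.card)⁻¹ : ℝ) else ((2 * √D.card)⁻¹ : ℝ) else 0

/-- The part of `groverStart D` on the marked items. -/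
noncomputable def groverMarked (D : Finset I) (x : I → Bool) : QueryBasis I Bool → ℂ := fun z =>
  if x z.1 && z.2.2 then groverStart D z else 0

/-- The part of `groverStart D` on the unmarked items. -/
noncomputable def groverUnmarked (D : Finset I) (x : I → Bool) : QueryBasis I Bool → ℂ := fun z =>
  if x z.1 && z.2.2 then 0 else groverStart D z

theorem groverMarked_add_groverUnmarked (D : Finset I) (x : I → Bool) :
    groverMarked D x + groverUnmarked D x = groverStart D := by
  ext z
  by_cases h : x z.1 && z.2.2 <;> simp [groverMarked, groverUnmarked, h]

theorem queryMatrix_mulVec_groverMarked (D : Finset I) (x : I → Bool) :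
    queryMatrix x *ᵥ groverMarked D x = - groverMarked D x := by
  rw [queryMatrix_mulVec]
  ext ⟨i, y, w⟩
  by_cases hi : i ∈ D <;> cases hx : x i <;> cases y <;> cases w <;>
    simp [groverMarked, groverStart, hx, hi]

theorem queryMatrix_mulVec_groverUnmarked (D : Finset I) (x : I → Bool) :
    queryMatrix x *ᵥ groverUnmarked D x = groverUnmarked D x := by
  rw [queryMatrix_mulVec]
  ext ⟨i, y, w⟩
  by_cases hi : i ∈ D <;> cases hx : x i <;> cases y <;> cases w <;>
    simp [groverUnmarked, groverStart, hx, hi]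

theorem norm_sq_groverStart (D : Finset I) (z : QueryBasis I Bool) :
    ‖groverStart D z‖ ^ 2 = if z.1 ∈ D then (4 * D.card : ℝ)⁻¹ else 0 := by
  have h : |(2 * √D.card)⁻¹| ^ 2 = (4 * D.card : ℝ)⁻¹ := by
    rw [sq_abs, inv_pow, mul_pow, Real.sq_sqrt (by positivity)]
    norm_num
  by_cases hi : z.1 ∈ D
  · simp only [groverStart, hi, if_true]
    split_ifs
    · rw [norm_neg, Complex.norm_real, Real.norm_eq_abs, h]
    · rw [Complex.norm_real, Real.norm_eq_abs, h]
  · simp [groverStart, hi]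

theorem star_groverStart_dotProduct_groverMarked (D : Finset I) (x : I → Bool) :
    star (groverStart D) ⬝ᵥ groverMarked D x =
      (((D.filter fun i => x i = true).card / (2 * D.card) : ℝ) : ℂ) := by
  have h : ∀ z, star (groverStart D z) * groverMarked D x z =
      ((if x z.1 && z.2.2 then if z.1 ∈ D then (4 * D.card : ℝ)⁻¹ else 0 else 0 : ℝ) : ℂ) := by
    intro z
    rw [← norm_sq_groverStart, groverMarked]
    split_ifs
    · simp [Complex.conj_mul']
    · simp
  simp only [dotProduct, Pi.star_apply, h, ← Complex.ofReal_sum]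
  congr 1
  simp only [Fintype.sum_prod_type, Fintype.sum_bool, Bool.and_true, Bool.and_false]
  rw [Finset.card_filter, Nat.cast_sum, Finset.sum_div, ← Finset.sum_filter_add_sum_filter_not
    Finset.univ (· ∈ D)]
  rw [Finset.sum_eq_zero (s := Finset.univ.filter (· ∉ D))]
  · simp only [Finset.filter_univ_mem, add_zero]
    refine Finset.sum_congr rfl fun i hi => ?_
    by_cases hx : x i
    · simp [hi, hx]
      ring
    · simp [hx]
  · intro i hi
    simp [(Finset.mem_filter.1 hi).2]

theorem star_groverStart_dotProduct_groverStart (D : Finset I) (hD : D.Nonempty) :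
    star (groverStart D) ⬝ᵥ groverStart D = 1 := by
  have h0 : (D.card : ℝ) ≠ 0 := by exact_mod_cast hD.card_pos.ne'
  have h : ∀ z, star (groverStart D z) * groverStart D z =
      ((if z.1 ∈ D then (4 * D.card : ℝ)⁻¹ else 0 : ℝ) : ℂ) := by
    intro z
    rw [← norm_sq_groverStart]
    simp [Complex.conj_mul']
  simp only [dotProduct, Pi.star_apply, h, ← Complex.ofReal_sum]
  norm_cast
  simp only [Fintype.sum_prod_type, Fintype.sum_bool]
  simp only [← two_mul, ← Finset.mul_sum, Finset.sum_ite_mem, Finset.univ_inter, Finset.sum_const,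
    nsmul_eq_mul]
  field_simp
  norm_num

/-- The unitaries of Grover's search over `D`, where `U₀` prepares the initial state. -/
noncomputable def groverUnitary (D : Finset I) (hD : D.Nonempty)
    (U₀ : Matrix.unitaryGroup (QueryBasis I Bool) ℂ) (t : ℕ) :
    Matrix.unitaryGroup (QueryBasis I Bool) ℂ :=
  if t = 0 then U₀ else
    Matrix.lineReflection (groverStart D) (star_groverStart_dotProduct_groverStart D hD)

/-- A query followed by the reflection about the start vector rotates the plane of the marked and
unmarked parts by `2θ`. -/
theorem evolve_groverUnitary (D : Finset I) (hD : D.Nonempty) (s : QueryBasis I Bool)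
    (U₀ : Matrix.unitaryGroup (QueryBasis I Bool) ℂ)
    (hU₀ : U₀.1 *ᵥ Pi.single s 1 = groverStart D) (x : I → Bool) (θ : ℝ)
    (hθ : Real.sin θ ^ 2 = (D.filter fun i => x i = true).card / (2 * D.card))
    (hsin : Real.sin θ ≠ 0) (hcos : Real.cos θ ≠ 0) (t : ℕ) :
    evolve (groverUnitary D hD U₀) s x t =
      ((Real.sin ((2 * t + 1) * θ) / Real.sin θ : ℝ) : ℂ) • groverMarked D x +
        ((Real.cos ((2 * t + 1) * θ) / Real.cos θ : ℝ) : ℂ) • groverUnmarked D x := by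
  have hM := star_groverStart_dotProduct_groverMarked D x
  rw [← hθ] at hM
  have hN : star (groverStart D) ⬝ᵥ groverUnmarked D x = ((Real.cos θ ^ 2 : ℝ) : ℂ) := by
    have h := star_groverStart_dotProduct_groverStart D hD
    rw [← groverMarked_add_groverUnmarked D x, dotProduct_add,
      groverMarked_add_groverUnmarked, hM] at h
    rw [Real.cos_sq']
    push_cast at h ⊢
    linear_combination h
  induction t with
  | zero =>
    rw [evolve, groverUnitary, if_pos rfl, hU₀, ← groverMarked_add_groverUnmarked D x]
    simp [div_self hsin, div_self hcos]
  | succ t ih =>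
    rw [evolve, ih, groverUnitary, if_neg t.succ_ne_zero, Matrix.mulVec_add, Matrix.mulVec_smul, Matrix.mulVec_smul,
      queryMatrix_mulVec_groverMarked, queryMatrix_mulVec_groverUnmarked,
      Matrix.lineReflection_mulVec, dotProduct_add, dotProduct_smul, dotProduct_smul,
      dotProduct_neg, hM, hN, ← groverMarked_add_groverUnmarked D x]
    have e : (2 * ((t + 1 : ℕ) : ℝ) + 1) * θ = (2 * t + 1) * θ + 2 * θ := by push_cast; ring
    rw [e, Real.sin_add, Real.cos_add, Real.sin_two_mul, Real.cos_two_mul]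
    set a := Real.sin ((2 * t + 1) * θ)
    set b := Real.cos ((2 * t + 1) * θ)
    have hsq := Real.sin_sq_add_cos_sq θ
    have e1 : (a * (2 * Real.cos θ ^ 2 - 1) + b * (2 * Real.sin θ * Real.cos θ)) / Real.sin θ =
        2 * (-(a / Real.sin θ * Real.sin θ ^ 2) + b / Real.cos θ * Real.cos θ ^ 2) +
          a / Real.sin θ := by
      field_simp
      linear_combination 2 * a * hsq
    have e2 : (b * (2 * Real.cos θ ^ 2 - 1) - a * (2 * Real.sin θ * Real.cos θ)) / Real.cos θ =
        2 * (-(a / Real.sin θ * Real.sin θ ^ 2) + b / Real.cos θ * Real.cos θ ^ 2) -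
          b / Real.cos θ := by
      field_simp
      ring
    rw [e1, e2]
    ext z
    simp only [Pi.add_apply, Pi.smul_apply, Pi.sub_apply, Pi.neg_apply, smul_eq_mul]
    push_cast
    ring

/-- Multiplied by `4 sin 2θ`, the sum telescopes to `2m sin 2θ - sin 4mθ`, and the last term is at
most `1 ≤ m sin 2θ`. -/
theorem sum_sin_sq_odd_mul_ge (m : ℕ) (θ : ℝ) (h : 1 ≤ m * Real.sin (2 * θ)) :
    (m : ℝ) / 4 ≤ ∑ j ∈ Finset.range m, Real.sin ((2 * j + 1) * θ) ^ 2 := by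
  have key : ∀ m : ℕ, 4 * Real.sin (2 * θ) * ∑ j ∈ Finset.range m, Real.sin ((2 * j + 1) * θ) ^ 2 =
      2 * m * Real.sin (2 * θ) - Real.sin (4 * m * θ) := by
    intro m
    induction m with
    | zero => simp
    | succ m ih =>
      rw [Finset.sum_range_succ, mul_add, ih, Real.sin_sq_eq_half_sub]
      have e1 : 4 * ((m + 1 : ℕ) : ℝ) * θ = 2 * ((2 * m + 1) * θ) + 2 * θ := by push_cast; ring
      have e2 : 4 * (m : ℝ) * θ = 2 * ((2 * m + 1) * θ) - 2 * θ := by ring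
      rw [e1, e2, Real.sin_add, Real.sin_sub]
      push_cast
      ring
  have hpos : 0 < Real.sin (2 * θ) := by
    by_contra hs
    nlinarith [Nat.cast_nonneg (α := ℝ) m]
  have := key m
  have h1 := Real.sin_le_one (4 * m * θ)
  refine le_of_mul_le_mul_left (a := 4 * Real.sin (2 * θ)) ?_ (by positivity)
  rw [this]
  linarith

/-- Grover's search with a fixed number of iterations. -/
theorem exists_realizable_grover [Nonempty I] (D : Finset I) (hD : D.Nonempty) (j : ℕ) :
    ∃ E : (I → Bool) → (I → ℝ) → ℝ, Realizable j E ∧ ∀ (x : I → Bool) (θ : ℝ),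
      Real.sin θ ^ 2 = (D.filter fun i => x i = true).card / (2 * D.card) →
      Real.sin θ ≠ 0 → Real.cos θ ≠ 0 → Real.sin ((2 * j + 1) * θ) ^ 2 ≤
        E x fun i => if i ∈ D ∧ x i = true then 1 else 0 := by
  let s : QueryBasis I Bool := (Classical.arbitrary I, false, false)
  obtain ⟨U₀, hU₀⟩ := Matrix.exists_unitary_mulVec_single s (groverStart D)
    (star_groverStart_dotProduct_groverStart D hD) (by
      simp only [groverStart]
      split_ifs <;> simp)
  let A : QuantumDecisionTree I := ⟨j, Bool, s, groverUnitary D hD U₀, fun _ => true⟩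
  refine ⟨A.expect fun z => z.1, ⟨A, fun z => z.1, rfl, fun _ _ => rfl⟩,
    fun x θ hθ hsin hcos => ?_⟩
  have hstate : A.state x j = _ := (state_eq_evolve A x j).trans
    (evolve_groverUnitary D hD s U₀ hU₀ x θ hθ hsin hcos j)
  have hM : ∑ z, ‖groverMarked D x z‖ ^ 2 = Real.sin θ ^ 2 := by
    have h := star_groverStart_dotProduct_groverMarked D x
    rw [← hθ] at h
    have e : ∀ z, star (groverStart D z) * groverMarked D x z =
        ((‖groverMarked D x z‖ ^ 2 : ℝ) : ℂ) := by
      intro z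
      rw [groverMarked]
      split_ifs
      · simp [Complex.conj_mul']
      · simp
    simp only [dotProduct, Pi.star_apply, e] at h
    exact_mod_cast h
  calc Real.sin ((2 * j + 1) * θ) ^ 2
      = ∑ z, (Real.sin ((2 * j + 1) * θ) / Real.sin θ) ^ 2 * ‖groverMarked D x z‖ ^ 2 := by
        rw [← Finset.mul_sum, hM]
        field_simp
    _ ≤ _ := by
        refine Finset.sum_le_sum fun (z : QueryBasis I Bool) _ => ?_
        change _ ≤ ‖A.state x j z‖ ^ 2 * _
        rw [hstate]
        by_cases h1 : (x z.1 && z.2.2) = true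
        · by_cases h2 : z.1 ∈ D
          · have h3 : x z.1 = true := (Bool.and_eq_true_iff.1 h1).1
            have h4 : groverUnmarked D x z = 0 := by rw [groverUnmarked, if_pos h1]
            beta_reduce
            rw [if_pos ⟨h2, h3⟩, mul_one, Pi.add_apply, Pi.smul_apply, Pi.smul_apply, h4,
              smul_zero, add_zero, norm_smul, mul_pow, Complex.norm_real, Real.norm_eq_abs, sq_abs]
          · simp only [groverMarked, groverStart, h1, h2, if_false, if_true]
            simp
        · simp only [groverMarked, h1]
          simp
          positivity

/-- Grover's search when a lower bound on the number of marked items is known. -/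
theorem exists_realizable_search [Nonempty I] (D : Finset I) (m : ℕ) (hm : 0 < m) :
    ∃ E : (I → Bool) → (I → ℝ) → ℝ, Realizable m E ∧ ∀ x : I → Bool, D.Nonempty →
      D.card ≤ m ^ 2 * (D.filter fun i => x i = true).card →
      1 / 4 ≤ E x fun i => if i ∈ D ∧ x i = true then 1 else 0 := by
  by_cases hD : D.Nonempty
  swap
  · exact ⟨_, Realizable.idle m (Classical.arbitrary I), fun x h => absurd h hD⟩
  choose E hE hE' using exists_realizable_grover D hD
  -- As the number of marked items is unknown, the number of iterations is uniform below `m`;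
  -- shorter runs are padded with idle queries.
  have hr := (Realizable.uniform (I := I) m hm).bind
    fun j : Fin m => (hE j).of_le (T' := m) j.2.le
  rw [zero_add] at hr
  refine ⟨_, hr, fun x _ hx => ?_⟩
  set t := (D.filter fun i => x i = true).card with ht
  have hN : 0 < D.card := hD.card_pos
  have htN : t ≤ D.card := Finset.card_filter_le _ _
  have ht0 : 0 < t := by
    rcases Nat.eq_zero_or_pos t with h | h
    · rw [h] at hx
      omega
    · exact h
  have hN' : (0 : ℝ) < D.card := by exact_mod_cast hN
  have ht0' : (0 : ℝ) < t := by exact_mod_cast ht0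
  have htN' : (t : ℝ) ≤ D.card := by exact_mod_cast htN
  have hx' : (D.card : ℝ) ≤ m ^ 2 * t := by exact_mod_cast hx
  have hq : (t : ℝ) / (2 * D.card) ≤ 1 / 2 := by
    rw [div_le_div_iff₀ (by positivity) (by positivity)]
    linarith
  have hsin : Real.sin (Real.arcsin √(t / (2 * D.card))) = √(t / (2 * D.card)) :=
    Real.sin_arcsin (by linarith [Real.sqrt_nonneg (t / (2 * D.card) : ℝ)])
      (Real.sqrt_le_one.2 (by linarith))
  have hcos : Real.cos (Real.arcsin √(t / (2 * D.card))) = √(1 - t / (2 * D.card)) := by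
    rw [Real.cos_arcsin, Real.sq_sqrt (by positivity)]
  set θ := Real.arcsin √(t / (2 * D.card))
  have hs2 : Real.sin θ ^ 2 = t / (2 * D.card) := by
    rw [hsin, Real.sq_sqrt (by positivity)]
  have hc2 : 1 / 2 ≤ Real.cos θ ^ 2 := by
    rw [Real.cos_sq', hs2]
    linarith
  have hs0 : 0 < Real.sin θ := by
    rw [hsin]
    positivity
  have hc0 : 0 < Real.cos θ := by
    rw [hcos]
    exact Real.sqrt_pos.2 (by linarith)
  -- Since `cos² θ ≥ 1/2`, `sin² 2θ ≥ 2 sin² θ = t / |D| ≥ 1 / m²`.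
  have hm2 : 1 ≤ m * Real.sin (2 * θ) := by
    rw [Real.sin_two_mul]
    have h : 1 ≤ (m * (2 * Real.sin θ * Real.cos θ)) ^ 2 := by
      have e : (m * (2 * Real.sin θ * Real.cos θ)) ^ 2 =
          (m ^ 2 * t / D.card) * (2 * Real.cos θ ^ 2) := by
        rw [mul_pow, mul_pow, mul_pow, hs2]
        field_simp
      rw [e]
      have : 1 ≤ m ^ 2 * t / (D.card : ℝ) := by rwa [le_div_iff₀ hN', one_mul]
      nlinarith
    exact (one_le_sq_iff₀ (by positivity)).1 h
  have hm' : (0 : ℝ) < m := by exact_mod_cast hm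
  rw [le_div_iff₀ hm']
  calc 1 / 4 * (m : ℝ) = m / 4 := by ring
    _ ≤ ∑ j ∈ Finset.range m, Real.sin ((2 * j + 1) * θ) ^ 2 := sum_sin_sq_odd_mul_ge m θ hm2
    _ = ∑ j : Fin m, Real.sin ((2 * (j : ℕ) + 1) * θ) ^ 2 :=
        (Fin.sum_univ_eq_sum_range (fun j => Real.sin ((2 * (j : ℝ) + 1) * θ) ^ 2) m).symm
    _ ≤ _ := Finset.sum_le_sum fun j _ => hE' j x θ hs2 hs0.ne' hc0.ne'

end QuantumDecisionTree

/-! ### Base exchanges and separators -/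

namespace Matroid

variable {α : Type*} {M : Matroid α} {B X : Set α}

/-- For `e ∈ X \ B`, every other element `b` of the fundamental circuit of `e` can be exchanged for
`e`, hence lies in `X`. So `B ∩ X` spans `X`. -/
theorem IsBase.eRk_le_encard_inter (hB : M.IsBase B) (hX : X ⊆ M.E)
    (h : ∀ b ∈ B \ X, ∀ e ∈ X \ B, ¬ M.Indep (insert e (B \ {b}))) :
    M.eRk X ≤ (B ∩ X).encard := by
  have key : X ⊆ M.closure (B ∩ X) := by
    intro e he
    by_cases heB : e ∈ B
    · exact M.mem_closure_of_mem ⟨heB, he⟩ (Set.inter_subset_right.trans hX)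
    have hC := hB.fundCircuit_isCircuit (hX he) heB
    refine M.closure_subset_closure ?_
      (hC.mem_closure_sdiff_singleton_of_mem (M.mem_fundCircuit e B))
    rintro b ⟨hb, hbe⟩
    have hbe' : b ≠ e := hbe
    have hbB : b ∈ B := (M.fundCircuit_subset_insert e B hb).resolve_left hbe'
    refine ⟨hbB, by_contra fun hbX => h b ⟨hbB, hbX⟩ e ⟨he, heB⟩ ?_⟩
    have h1 := (hB.indep.mem_fundCircuit_iff (by rw [hB.closure_eq]; exact hX he) heB).1 hb
    rwa [← Set.insert_sdiff_singleton_comm hbe'.symm] at h1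
  calc M.eRk X ≤ M.eRk (M.closure (B ∩ X)) := M.eRk_mono key
    _ = M.eRk (B ∩ X) := M.eRk_closure_eq _
    _ ≤ _ := M.eRk_le_encard _

/-- In a connected matroid, each nonempty proper subset of the ground set is crossed by an exchange
between a base and its complement. -/
theorem IsConnected.exists_exchange (hM : M.IsConnected) (hB : M.IsBase B) (hX : X.Nonempty)
    (hXE : X ⊂ M.E) :
    ∃ b ∈ B, ∃ e ∈ M.E \ B, M.Indep (insert e (B \ {b})) ∧ (b ∈ X ↔ e ∉ X) := by
  by_contra! hcon
  have h1 : M.eRk X ≤ (B ∩ X).encard := hB.eRk_le_encard_inter hXE.subset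
    fun b hb e he hi => by
      have := hcon b hb.1 e ⟨hXE.subset he.1, he.2⟩ hi
      have h2 := hb.2
      have h3 := he.1
      tauto
  have h2 : M.eRk (M.E \ X) ≤ (B ∩ (M.E \ X)).encard := hB.eRk_le_encard_inter Set.sdiff_subset
    fun b hb e he hi => by
      have := hcon b hb.1 e ⟨he.1.1, he.2⟩ hi
      have h2 : b ∈ X := by_contra fun h => hb.2 ⟨hB.subset_ground hb.1, h⟩
      have h3 := he.1.2
      tauto
  have h3 : B ∩ (M.E \ X) = B \ X := by
    ext b
    have := fun h : b ∈ B => hB.subset_ground h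
    simp only [Set.mem_inter_iff, Set.mem_sdiff]
    tauto
  have h4 := (hM X hX hXE).trans_le (add_le_add h1 h2)
  rw [h3, add_comm, Set.encard_sdiff_add_encard_inter, M.eRk_ground, hB.encard_eq_eRank] at h4
  exact lt_irrefl _ h4

/-- As `b ∉ X`, the set `(B ∩ X) + e` lies inside `B - b + e` and is independent, so `r(X)` exceeds
`|B ∩ X|`. -/
theorem IsBase.lt_eRk_add_eRk [M.RankFinite] (hB : M.IsBase B) {b e : α} (hbX : b ∉ X)
    (heX : e ∈ X) (heB : e ∉ B) (hi : M.Indep (insert e (B \ {b}))) :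
    M.eRk M.E < M.eRk X + M.eRk (M.E \ X) := by
  have h1 : (B ∩ X).encard + 1 ≤ M.eRk X := by
    rw [← Set.encard_insert_of_notMem (a := e) fun h => heB h.1]
    refine Indep.encard_le_eRk_of_subset (hi.subset (Set.insert_subset_insert ?_))
      (Set.insert_subset heX Set.inter_subset_right)
    rintro c ⟨hc, hcX⟩
    exact ⟨hc, fun h => hbX (h ▸ hcX)⟩
  have h2 : (B \ X).encard ≤ M.eRk (M.E \ X) :=
    Indep.encard_le_eRk_of_subset (hB.indep.subset Set.sdiff_subset)
      (Set.sdiff_subset_sdiff_left hB.subset_ground)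
  have h3 := add_le_add h1 h2
  rw [add_right_comm, add_comm (B ∩ X).encard, Set.encard_sdiff_add_encard_inter] at h3
  rw [M.eRk_ground, ← hB.encard_eq_eRank]
  exact ((ENat.lt_add_one_iff' hB.finite.encard_lt_top.ne).2 le_rfl).trans_le h3

/-- An exchange between a base and its complement does not cross a separator. -/
theorem IsBase.mem_iff_mem_of_eRk_add_eRk_le [M.RankFinite] (hB : M.IsBase B) (hX : X ⊆ M.E)
    (h : M.eRk X + M.eRk (M.E \ X) ≤ M.eRk M.E) {b e : α} (heE : e ∈ M.E)
    (heB : e ∉ B) (hi : M.Indep (insert e (B \ {b}))) : b ∈ X ↔ e ∈ X := by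
  constructor
  · intro hb
    by_contra he
    have := hB.lt_eRk_add_eRk (X := M.E \ X) (fun h => h.2 hb) ⟨heE, he⟩ heB hi
    rw [Set.sdiff_sdiff_cancel_left hX, add_comm] at this
    exact absurd this h.not_gt
  · intro he
    by_contra hb
    exact absurd (hB.lt_eRk_add_eRk hb he heB hi) h.not_gt

end Matroid

/-! ### The greedy algorithm -/

section greedy

variable {E : Type*} [DecidableEq E]

/-- The greedy algorithm for a maximal independent set. -/
def greedyBase (x : Finset E → Bool) : List E → Finset E → Finset E
  | [], B => B
  | e :: l, B => greedyBase x l (if x (insert e B) then insert e B else B)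

theorem subset_greedyBase (x : Finset E → Bool) (l : List E) (B : Finset E) :
    B ⊆ greedyBase x l B := by
  induction l generalizing B with
  | nil => exact subset_rfl
  | cons e l ih =>
    rw [greedyBase]
    refine subset_trans ?_ (ih _)
    split_ifs
    · exact Finset.subset_insert _ _
    · exact subset_rfl

theorem indep_greedyBase (M : Matroid E) (l : List E) {B : Finset E} (hB : M.Indep (B : Set E)) :
    M.Indep (greedyBase M.indepOracle l B : Set E) := by
  induction l generalizing B with
  | nil => exact hB
  | cons e l ih =>
    rw [greedyBase]
    split_ifs with h
    · exact ih (by simpa [Matroid.indepOracle] using h)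
    · exact ih hB

/-- The greedy set only grows, so an element that could be added at the end could have been added at
its turn. -/
theorem mem_greedyBase_of_indep (M : Matroid E) (l : List E) (B : Finset E) {e : E} (he : e ∈ l)
    (hi : M.Indep (insert e (greedyBase M.indepOracle l B) : Set E)) :
    e ∈ greedyBase M.indepOracle l B := by
  induction l generalizing B with
  | nil => simp at he
  | cons a l ih =>
    rw [greedyBase] at hi ⊢
    rcases List.mem_cons.1 he with rfl | he
    · have h : M.indepOracle (insert e B) = true := by
        simp only [Matroid.indepOracle, decide_eq_true_eq]
        refine hi.subset ?_
        rw [Finset.coe_insert]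
        refine Set.insert_subset_insert (Finset.coe_subset.2 ?_)
        refine subset_trans ?_ (subset_greedyBase _ _ _)
        split_ifs
        · exact Finset.subset_insert _ _
        · exact subset_rfl
      rw [if_pos h]
      exact subset_greedyBase _ _ _ (Finset.mem_insert_self _ _)
    · exact ih _ he hi

theorem isBase_greedyBase [Fintype E] (M : Matroid E) :
    M.IsBase (greedyBase M.indepOracle Finset.univ.toList ∅ : Set E) := by
  rw [Matroid.isBase_iff_maximal_indep]
  refine ⟨indep_greedyBase M _ (by simp), fun J hJ hBJ e he => ?_⟩
  exact mem_greedyBase_of_indep M _ _ (by simp) (hJ.subset (Set.insert_subset he hBJ))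

open QuantumDecisionTree in
theorem realizable_greedyBase [Fintype E] (l : List E) (B : Finset E) :
    Realizable l.length fun (x : Finset E → Bool) (f : Finset E → ℝ) => f (greedyBase x l B) := by
  induction l generalizing B with
  | nil => exact Realizable.idle 0 B
  | cons e l ih =>
    rw [List.length_cons, add_comm]
    exact (Realizable.query (insert e B)).bind fun y => ih (if y then insert e B else B)

end greedy

/-! ### Iterated random rounds -/

namespace QuantumDecisionTree

variable {I σ : Type*}

/-- The expectation functional of a sequence of rounds: a round of parameter `m` at the state `c`
moves to a random state with the expectation functional `R m c`. -/
def runRounds (R : ℕ → σ → (I → Bool) → (σ → ℝ) → ℝ) :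
    List ℕ → σ → (I → Bool) → (σ → ℝ) → ℝ
  | [], c, _, f => f c
  | m :: l, c, x, f => R m c x fun c' => runRounds R l c' x f

theorem runRounds_append (R : ℕ → σ → (I → Bool) → (σ → ℝ) → ℝ) (l l' : List ℕ) (c : σ)
    (x : I → Bool) (f : σ → ℝ) :
    runRounds R (l ++ l') c x f = runRounds R l c x fun c' => runRounds R l' c' x f := by
  induction l generalizing c with
  | nil => rfl
  | cons m l ih => simp only [List.cons_append, runRounds, ih]

variable [Fintype I] [DecidableEq I] [Nonempty I]
  {R : ℕ → σ → (I → Bool) → (σ → ℝ) → ℝ} (hR : ∀ m c, Realizable (m + 2) (R m c))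
include hR

theorem realizable_runRounds (l : List ℕ) (c : σ) :
    Realizable (l.map (· + 2)).sum (runRounds R l c) := by
  induction l generalizing c with
  | nil => exact Realizable.idle 0 c
  | cons m l ih =>
    rw [List.map_cons, List.sum_cons]
    exact (hR m c).bind ih

omit [Nonempty I] in
theorem runRounds_le_self {x : I → Bool} {f : σ → ℝ} (hf : ∀ m c, R m c x f ≤ f c) (l : List ℕ)
    (c : σ) : runRounds R l c x f ≤ f c := by
  induction l generalizing c with
  | nil => exact le_rfl
  | cons m l ih => exact ((hR m c).mono x ih).trans (hf m c)

omit [Nonempty I] in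
-- From a state with `f ≤ b` the expectation never rises above `b`; from any other state one round
-- contracts it by `ρ`.
theorem runRounds_replicate_le {x : I → Bool} {f : σ → ℝ} (hf : ∀ m c, R m c x f ≤ f c)
    (hf0 : ∀ c, 0 ≤ f c) {m : ℕ} {ρ b : ℝ} (hρ : 0 ≤ ρ) (hb : 0 ≤ b)
    (hm : ∀ c, f c ≤ b ∨ R m c x f ≤ ρ * f c) (r : ℕ) (c : σ) :
    runRounds R (List.replicate r m) c x f ≤ ρ ^ r * f c + b := by
  induction r generalizing c with
  | zero =>
    rw [List.replicate_zero, runRounds]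
    linarith
  | succ r ih =>
    rcases hm c with h | h
    · have h1 := runRounds_le_self hR hf (List.replicate (r + 1) m) c
      have h2 := mul_nonneg (pow_nonneg hρ (r + 1)) (hf0 c)
      linarith
    · rw [List.replicate_succ, runRounds]
      refine ((hR m c).mono x ih).trans ?_
      rw [(hR m c).mul_add_const, pow_succ, mul_assoc]
      have := mul_le_mul_of_nonneg_left h (pow_nonneg hρ r)
      linarith

omit hR in
/-- The parameters of `21` rounds for each of the phases `q - 1, …, 0`. -/
def phases (μ : ℕ → ℕ) : ℕ → List ℕ
  | 0 => []
  | q + 1 => List.replicate 21 (μ q) ++ phases μ q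

/-- Phase `q` shrinks the potential by `1/16`, up to an additive `2^(q+1) - 2`. The failure
indicator is at most half the potential, so the constant is the sum over `i < q` of `1/2 · 16^(-i) ·
(2^(i+1) - 2) = 8^(-i) - 16^(-i)`. -/
theorem runRounds_phases_le {x : I → Bool} {k : σ → ℕ} (hk : ∀ c, 1 ≤ k c)
    (hf : ∀ m c, R m c x (fun c => 2 ^ k c - 2) ≤ 2 ^ k c - 2) {μ : ℕ → ℕ}
    (hμ : ∀ q c, q + 2 ≤ k c → R (μ q) c x (fun c => 2 ^ k c - 2) ≤ 7 / 8 * (2 ^ k c - 2))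
    (q : ℕ) (c : σ) :
    runRounds R (phases μ q) c x (fun c => if k c ≤ 1 then 0 else 1) ≤
      1 / 2 * (1 / 16) ^ q * (2 ^ k c - 2) +
        (8 / 7 * (1 - (1 / 8) ^ q) - 16 / 15 * (1 - (1 / 16) ^ q)) := by
  have hf0 : ∀ c, (0 : ℝ) ≤ 2 ^ k c - 2 := fun c => by
    have := pow_le_pow_right₀ (one_le_two : (1 : ℝ) ≤ 2) (hk c)
    linarith
  induction q generalizing c with
  | zero =>
    simp only [phases, runRounds]
    split_ifs with h
    · have := hf0 c
      norm_num
      linarith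
    · have := pow_le_pow_right₀ (one_le_two : (1 : ℝ) ≤ 2) (show 2 ≤ k c by omega)
      norm_num
      linarith
  | succ q ih =>
    have hr := realizable_runRounds hR (List.replicate 21 (μ q)) c
    rw [phases, runRounds_append]
    refine (hr.mono x ih).trans ?_
    rw [hr.mul_add_const]
    have h1 : runRounds R (List.replicate 21 (μ q)) c x (fun c => 2 ^ k c - 2) ≤
        (7 / 8) ^ 21 * (2 ^ k c - 2) + (2 ^ (q + 1) - 2) := by
      refine runRounds_replicate_le hR hf hf0 (by norm_num) ?_ (fun c => ?_) 21 c
      · have := pow_le_pow_right₀ (one_le_two : (1 : ℝ) ≤ 2) (show 1 ≤ q + 1 by omega)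
        linarith
      · rcases le_or_gt (q + 2) (k c) with h | h
        · exact Or.inr (hμ q c h)
        · have := pow_le_pow_right₀ (one_le_two : (1 : ℝ) ≤ 2) (show k c ≤ q + 1 by omega)
          exact Or.inl (by linarith)
    -- The number `21` of rounds is the least `r` with `(7/8)^r ≤ 1/16`.
    have h2 : ((7 : ℝ) / 8) ^ 21 * (2 ^ k c - 2) ≤ 1 / 16 * (2 ^ k c - 2) :=
      mul_le_mul_of_nonneg_right (by norm_num) (hf0 c)
    have h3 := mul_le_mul_of_nonneg_left (h1.trans (add_le_add_left h2 _))
      (show (0 : ℝ) ≤ 1 / 2 * (1 / 16) ^ q by positivity)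
    refine (add_le_add_left h3 _).trans (le_of_eq ?_)
    have e : ((1 : ℝ) / 8) ^ q = 2 ^ q * (1 / 16) ^ q := by
      rw [← mul_pow]
      norm_num
    rw [pow_succ (1 / 8 : ℝ), e]
    ring

omit hR in
theorem sum_map_phases (μ : ℕ → ℕ) (q : ℕ) :
    ((phases μ q).map (· + 2)).sum = ∑ i ∈ Finset.range q, 21 * (μ i + 2) := by
  induction q with
  | zero => rfl
  | succ q ih =>
    rw [phases, List.map_append, List.sum_append, ih, List.map_replicate, List.sum_replicate,
      smul_eq_mul, Finset.sum_range_succ, add_comm]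

end QuantumDecisionTree

/-! ### Merging the classes of a colouring along exchanges -/

section colouring

variable {E : Type*} [Fintype E] [DecidableEq E]

/-- The pairs between `B` and its complement whose ends have different colours. -/
def crossingPairs (B : Finset E) (c : E → E) : Finset (E × E) :=
  Finset.univ.filter fun p => p.1 ∈ B ∧ p.2 ∉ B ∧ c p.1 ≠ c p.2

/-- The set that arises from `B` by the exchange of the pair `p`. -/
def exchangeSet (B : Finset E) (p : E × E) : Finset E := insert p.2 (B.erase p.1)

omit [Fintype E] in
theorem indepOracle_exchangeSet (M : Matroid E) (B : Finset E) (p : E × E) :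
    M.indepOracle (exchangeSet B p) = true ↔ M.Indep (insert p.2 ((B : Set E) \ {p.1})) := by
  rw [Matroid.indepOracle, @decide_eq_true_eq, exchangeSet, Finset.coe_insert, Finset.coe_erase]

/-- The pair is recovered as the element missing from `B` and the one outside it. Hence counting
marked query sets amounts to counting exchanges. -/
theorem exchangeSet_injOn (B : Finset E) (c : E → E) :
    Set.InjOn (exchangeSet B) (crossingPairs B c : Set (E × E)) := by
  rintro ⟨b, e⟩ h ⟨b', e'⟩ h' heq
  simp only [crossingPairs, Finset.coe_filter, Finset.mem_univ, true_and, Set.mem_ofPred_eq] at h h'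
  simp only [exchangeSet, Finset.ext_iff, Finset.mem_insert, Finset.mem_erase] at heq
  have h1 := heq e
  have h2 := heq b
  grind

/-- The number of colours of a colouring. -/
def numColors (c : E → E) : ℕ := (Finset.univ.image c).card

/-- The colouring that arises from `c` when the classes of `u` and `v` are merged. -/
def mergeColors (c : E → E) (u v : E) : E → E := fun w => if c w = c u then c v else c w

theorem numColors_mergeColors_lt {c : E → E} {u v : E} (h : c u ≠ c v) :
    numColors (mergeColors c u v) < numColors c := by
  have h1 : Finset.univ.image (mergeColors c u v) ⊆ (Finset.univ.image c).erase (c u) := by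
    intro a ha
    obtain ⟨w, -, rfl⟩ := Finset.mem_image.1 ha
    rw [mergeColors]
    split_ifs with hw
    · exact Finset.mem_erase.2 ⟨h.symm, Finset.mem_image_of_mem c (Finset.mem_univ v)⟩
    · exact Finset.mem_erase.2 ⟨hw, Finset.mem_image_of_mem c (Finset.mem_univ w)⟩
  exact (Finset.card_le_card h1).trans_lt
    (Finset.card_erase_lt_of_mem (Finset.mem_image_of_mem c (Finset.mem_univ u)))

/-- In a connected matroid, each colour is met by an exchange that is not monochromatic. -/
theorem numColors_le_two_mul_card {M : Matroid E} (hE : M.E = Set.univ) (hM : M.IsConnected)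
    {B : Finset E} (hB : M.IsBase (B : Set E)) {c : E → E} (hc : 2 ≤ numColors c) :
    numColors c ≤ 2 * (((crossingPairs B c).image (exchangeSet B)).filter
      fun S => M.indepOracle S = true).card := by
  set P := (crossingPairs B c).filter fun p => M.indepOracle (exchangeSet B p) = true with hP
  have h1 : ((crossingPairs B c).image (exchangeSet B)).filter (fun S => M.indepOracle S = true) =
      P.image (exchangeSet B) := Finset.filter_image
  rw [h1, Finset.card_image_of_injOn
    ((exchangeSet_injOn B c).mono (Finset.coe_subset.2 (Finset.filter_subset _ _)))]
  -- Each colour class is left by an exchange, and an exchange has only two ends; this gives the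
  -- factor `2`.
  have h2 : Finset.univ.image c ⊆ P.image (fun p => c p.1) ∪ P.image (fun p => c p.2) := by
    intro a ha
    obtain ⟨u, -, rfl⟩ := Finset.mem_image.1 ha
    have hX : ({v | c v = c u} : Set E) ⊂ M.E := by
      rw [hE, Set.ssubset_univ_iff]
      intro h
      have h3 : Finset.univ.image c ⊆ {c u} := by
        intro a ha
        obtain ⟨v, -, rfl⟩ := Finset.mem_image.1 ha
        have : v ∈ {v | c v = c u} := h ▸ Set.mem_univ v
        simpa using this
      have := Finset.card_le_card h3
      rw [Finset.card_singleton] at this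
      rw [numColors] at hc
      omega
    obtain ⟨b, hb, e, he, hi, hbe⟩ := hM.exists_exchange hB (X := {v | c v = c u}) ⟨u, rfl⟩ hX
    simp only [Set.mem_ofPred_eq] at hbe
    have hp : (b, e) ∈ P := by
      simp only [hP, crossingPairs, Finset.mem_filter, Finset.mem_univ, true_and]
      refine ⟨⟨hb, he.2, fun h => ?_⟩, ?_⟩
      · rw [h] at hbe
        tauto
      · exact (indepOracle_exchangeSet M B (b, e)).2 hi
    rw [Finset.mem_union, Finset.mem_image, Finset.mem_image]
    by_cases h : c b = c u
    · exact Or.inl ⟨_, hp, h⟩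
    · exact Or.inr ⟨_, hp, by tauto⟩
  calc numColors c ≤ _ := Finset.card_le_card h2
    _ ≤ P.card + P.card := (Finset.card_union_le _ _).trans
        (add_le_add Finset.card_image_le Finset.card_image_le)
    _ = 2 * P.card := (two_mul _).symm

open Classical in
/-- The colouring after the answer `y` to a query of the set `S`. -/
noncomputable def recolor (B : Finset E) (c : E → E) (S : Finset E) (y : Bool) : E → E :=
  if h : y = true ∧ ∃ p ∈ crossingPairs B c, exchangeSet B p = S then
    mergeColors c h.2.choose.1 h.2.choose.2
  else c

theorem numColors_recolor_lt {B : Finset E} {c : E → E} {S : Finset E}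
    (hS : S ∈ (crossingPairs B c).image (exchangeSet B)) :
    numColors (recolor B c S true) < numColors c := by
  have h : true = true ∧ ∃ p ∈ crossingPairs B c, exchangeSet B p = S :=
    ⟨rfl, Finset.mem_image.1 hS⟩
  rw [recolor, dif_pos h]
  exact numColors_mergeColors_lt (Finset.mem_filter.1 h.2.choose_spec.1).2.2.2

theorem recolor_eq_or (B : Finset E) (c : E → E) (S : Finset E) (x : Finset E → Bool) :
    recolor B c S (x S) = c ∨ ∃ p ∈ crossingPairs B c, x (exchangeSet B p) = true ∧
      recolor B c S (x S) = mergeColors c p.1 p.2 := by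
  by_cases h : x S = true ∧ ∃ p ∈ crossingPairs B c, exchangeSet B p = S
  · refine Or.inr ⟨h.2.choose, h.2.choose_spec.1, ?_, by rw [recolor, dif_pos h]⟩
    rw [h.2.choose_spec.2, h.1]
  · exact Or.inl (by rw [recolor, dif_neg h])

open QuantumDecisionTree

/-- A round searches for an independent exchange between different classes and merges them. -/
theorem exists_realizable_round (B : Finset E) (m : ℕ) (c : E → E) :
    ∃ R : (Finset E → Bool) → ((E → E) → ℝ) → ℝ, Realizable (m + 2) R ∧
      (∀ x, ((crossingPairs B c).image (exchangeSet B)).Nonempty →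
        ((crossingPairs B c).image (exchangeSet B)).card ≤ (m + 1) ^ 2 *
          (((crossingPairs B c).image (exchangeSet B)).filter fun S => x S = true).card →
        1 / 4 ≤ R x fun c' => if numColors c' < numColors c then 1 else 0) ∧
      -- This monotonicity encodes the support: a round either keeps `c` or merges along an
      -- independent crossing exchange.
      ∀ x f g, f c ≤ g c → (∀ p ∈ crossingPairs B c, x (exchangeSet B p) = true →
        f (mergeColors c p.1 p.2) ≤ g (mergeColors c p.1 p.2)) → R x f ≤ R x g := by
  obtain ⟨R, hR, hR'⟩ :=
    exists_realizable_search ((crossingPairs B c).image (exchangeSet B)) (m + 1) m.succ_pos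
  -- The search result is verified by one more query, so the cost is `(m + 1) + 1`.
  have hr := hR.bind fun S => (Realizable.query S).map (recolor B c S)
  refine ⟨_, hr, fun x hx hx' => (hR' x hx hx').trans (hR.mono x fun S => ?_),
    fun x f g h1 h2 => hR.mono x fun S => ?_⟩
  · beta_reduce
    by_cases h : S ∈ (crossingPairs B c).image (exchangeSet B) ∧ x S = true
    · rw [if_pos h, h.2, if_pos (numColors_recolor_lt h.1)]
    · rw [if_neg h]
      split_ifs <;> norm_num
  · beta_reduce
    rcases recolor_eq_or B c S x with h | ⟨p, hp, hx, h⟩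
    · rw [h]
      exact h1
    · rw [h]
      exact h2 p hp hx

end colouring

/-! ### Query count, potential and correctness -/

section connectivity

open QuantumDecisionTree

variable {E : Type*} [Fintype E] [DecidableEq E]

theorem one_le_numColors [Nonempty E] (c : E → E) : 1 ≤ numColors c :=
  (Finset.univ_nonempty.image c).card_pos

theorem numColors_le_card (c : E → E) : numColors c ≤ Fintype.card E :=
  Finset.card_image_le

theorem card_exchangeSet_image_le (B : Finset E) (c : E → E) :
    ((crossingPairs B c).image (exchangeSet B)).card ≤ Fintype.card E ^ 2 := by
  refine Finset.card_image_le.trans ((Finset.card_le_univ _).trans ?_)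
  rw [Fintype.card_prod, pow_two]

theorem two_pow_numColors_mergeColors_le {c : E → E} {u v : E} (h : c u ≠ c v) :
    (2 : ℝ) ^ numColors (mergeColors c u v) ≤ 2 ^ numColors c / 2 := by
  rw [le_div_iff₀ two_pos, ← pow_succ]
  exact pow_le_pow_right₀ one_le_two (numColors_mergeColors_lt h)

/-- The number of iterations of the searches in the phase with more than `q + 1` colours on a
ground set with `n` elements. -/
noncomputable def searchLength (n q : ℕ) : ℕ := ⌊2 * n / √(q + 1 : ℝ)⌋₊

/-- The `+ 1` compensates for the floor: `(2n)² ≤ (searchLength n q + 1)² (q + 1)`, and `q + 1 ≤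
2t`. -/
theorem card_sq_le_searchLength (n q t : ℕ) (h : q + 1 ≤ 2 * t) :
    n ^ 2 ≤ (searchLength n q + 1) ^ 2 * t := by
  have h1 : 2 * n / √(q + 1 : ℝ) ≤ searchLength n q + 1 := (Nat.lt_floor_add_one _).le
  rw [div_le_iff₀ (by positivity)] at h1
  have h2 : (2 * n : ℝ) ^ 2 ≤ ((searchLength n q + 1) * √(q + 1 : ℝ)) ^ 2 :=
    pow_le_pow_left₀ (by positivity) h1 2
  rw [mul_pow _ √(q + 1 : ℝ), Real.sq_sqrt (by positivity)] at h2
  have h3 : (q + 1 : ℝ) ≤ 2 * t := by exact_mod_cast h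
  have h4 := mul_le_mul_of_nonneg_left h3 (sq_nonneg (searchLength n q + 1 : ℝ))
  have h5 : (n ^ 2 : ℝ) ≤ (searchLength n q + 1) ^ 2 * t := by nlinarith
  exact_mod_cast h5

theorem sum_inv_sqrt_le (n : ℕ) : ∑ q ∈ Finset.range n, 1 / √(q + 1 : ℝ) ≤ 2 * √n := by
  induction n with
  | zero => simp
  | succ n ih =>
    rw [Finset.sum_range_succ]
    push_cast
    have h1 : 0 < √(n + 1 : ℝ) := Real.sqrt_pos.2 (by positivity)
    have h2 := Real.mul_self_sqrt (show (0 : ℝ) ≤ n by positivity)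
    have h3 := Real.mul_self_sqrt (show (0 : ℝ) ≤ n + 1 by positivity)
    -- This comparison makes the sum telescope.
    have h4 : 1 / √(n + 1 : ℝ) ≤ 2 * √(n + 1 : ℝ) - 2 * √n := by
      rw [div_le_iff₀ h1]
      nlinarith [sq_nonneg (√(n + 1 : ℝ) - √n)]
    linarith

/-- The total is at most `n + 21 (4 n √n + 2n) = 84 n √n + 43 n`, and `84 + 43 = 127`. -/
theorem card_add_sum_searchLength_le (n : ℕ) :
    ((n + ∑ q ∈ Finset.range n, 21 * (searchLength n q + 2) : ℕ) : ℝ) ≤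
      127 * (n : ℝ) ^ (3 / 2 : ℝ) := by
  have h1 : (n : ℝ) ^ (3 / 2 : ℝ) = n * √n := by
    rcases Nat.eq_zero_or_pos n with rfl | hn
    · rw [Nat.cast_zero, Real.zero_rpow (by norm_num), zero_mul]
    · rw [show (3 / 2 : ℝ) = 1 + 1 / 2 by norm_num, Real.rpow_add (by exact_mod_cast hn),
        Real.rpow_one, Real.sqrt_eq_rpow]
  have h2 : (n : ℝ) ≤ n * √n := by
    rcases Nat.eq_zero_or_pos n with rfl | hn
    · simp
    · exact le_mul_of_one_le_right (by positivity) (Real.one_le_sqrt.2 (by exact_mod_cast hn))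
  have h3 : ∑ q ∈ Finset.range n, (searchLength n q : ℝ) ≤ 2 * n * (2 * √n) := by
    refine le_trans ?_ (mul_le_mul_of_nonneg_left (sum_inv_sqrt_le n) (by positivity))
    rw [Finset.mul_sum]
    refine Finset.sum_le_sum fun q _ => ?_
    rw [mul_one_div]
    exact Nat.floor_le (by positivity)
  push_cast
  rw [h1, ← Finset.mul_sum, Finset.sum_add_distrib, Finset.sum_const, Finset.card_range,
    nsmul_eq_mul]
  nlinarith

section rounds

variable {B : Finset E} {x : Finset E → Bool} {R : (Finset E → Bool) → ((E → E) → ℝ) → ℝ}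
  {T : ℕ} (hR : Realizable T R) {c : E → E}
  (hsupp : ∀ f g, f c ≤ g c → (∀ p ∈ crossingPairs B c, x (exchangeSet B p) = true →
    f (mergeColors c p.1 p.2) ≤ g (mergeColors c p.1 p.2)) → R x f ≤ R x g)
include hR hsupp

theorem round_two_pow_numColors_le : R x (fun c => 2 ^ numColors c - 2) ≤ 2 ^ numColors c - 2 := by
  refine (hsupp _ (fun _ => 2 ^ numColors c - 2) le_rfl fun p hp _ => ?_).trans_eq (hR.const x _)
  have := two_pow_numColors_mergeColors_le (Finset.mem_filter.1 hp).2.2.2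
  have h2 : (0 : ℝ) < 2 ^ numColors c := by positivity
  linarith

/-- With probability at least `1/4` a merge removes at least half of `2^k`, so the expected
potential is at most `7/8 · 2^k - 2`. -/
theorem round_two_pow_numColors_le_mul
    (h : 1 / 4 ≤ R x fun c' => if numColors c' < numColors c then 1 else 0) :
    R x (fun c => 2 ^ numColors c - 2) ≤ 7 / 8 * (2 ^ numColors c - 2) := by
  have h1 := hsupp (fun c => 2 ^ numColors c - 2)
    (fun c' => -(2 ^ numColors c / 2) * (if numColors c' < numColors c then 1 else 0) +
      (2 ^ numColors c - 2)) (by simp) fun p hp _ => by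
    have h2 := (Finset.mem_filter.1 hp).2.2.2
    have h3 := two_pow_numColors_mergeColors_le h2
    rw [if_pos (numColors_mergeColors_lt h2)]
    linarith
  rw [hR.mul_add_const] at h1
  have h2 : (0 : ℝ) < 2 ^ numColors c := by positivity
  nlinarith

open Classical in
-- Merging along an exchange that does not cross `X` keeps `X` a union of colour classes.
theorem round_separator_le {X : Set E} (hX : ∀ p ∈ crossingPairs B c,
      x (exchangeSet B p) = true → (p.1 ∈ X ↔ p.2 ∈ X)) :
    R x (fun c => if ∀ u v, c u = c v → (u ∈ X ↔ v ∈ X) then 0 else 1) ≤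
      if ∀ u v, c u = c v → (u ∈ X ↔ v ∈ X) then 0 else 1 := by
  by_cases hc : ∀ u v, c u = c v → (u ∈ X ↔ v ∈ X)
  · rw [if_pos hc]
    refine (hsupp _ (fun _ => 0) (by rw [if_pos hc]) fun p hp hpx => ?_).trans_eq (hR.const x _)
    rw [if_pos]
    intro u v huv
    have h1 := hX p hp hpx
    have h2 := hc u v
    have h3 := hc u p.1
    have h4 := hc v p.1
    have h5 := hc u p.2
    have h6 := hc v p.2
    simp only [mergeColors] at huv
    split_ifs at huv with h7 h8 h8
    · rw [h3 h7, h4 h8]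
    · rw [h3 h7, h6 huv.symm, h1]
    · rw [h4 h8, h5 huv, h1]
    · exact h2 huv
  · rw [if_neg hc]
    refine (hR.mono x fun c' => ?_).trans_eq (hR.const x 1)
    split_ifs <;> norm_num

end rounds

/-- The decision whether a matroid is connected when a base `B` is known. -/
theorem exists_realizable_isConnected [Nonempty E] (B : Finset E) :
    ∃ R : (Finset E → Bool) → (Bool → ℝ) → ℝ,
      Realizable (∑ q ∈ Finset.range (Fintype.card E),
        21 * (searchLength (Fintype.card E) q + 2)) R ∧
      ∀ M : Matroid E, M.E = Set.univ → M.IsBase (B : Set E) →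
        (M.IsConnected → R M.indepOracle (fun y => if y = true then 0 else 1) ≤ 1 / 3) ∧
        (¬ M.IsConnected → R M.indepOracle (fun y => if y = true then 1 else 0) ≤ 0) := by
  classical
  choose R hR hsucc hsupp using exists_realizable_round B
  have hrun := realizable_runRounds hR
    (phases (searchLength (Fintype.card E)) (Fintype.card E)) id
  rw [sum_map_phases] at hrun
  refine ⟨_, hrun.map fun c => decide (numColors c ≤ 1), fun M hE hB => ⟨fun hM => ?_, fun hM => ?_⟩⟩
  · have h := runRounds_phases_le hR (x := M.indepOracle) one_le_numColors
      (fun m c => round_two_pow_numColors_le (hR m c) (hsupp m c _))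
      (μ := searchLength (Fintype.card E)) (fun q c hq => by
        have h1 := numColors_le_two_mul_card hE hM hB (c := c) (by omega)
        refine round_two_pow_numColors_le_mul (hR _ c) (hsupp _ c _) (hsucc _ c _ ?_ ?_)
        · rw [← Finset.card_pos]
          refine lt_of_lt_of_le ?_ (Finset.card_filter_le _ fun S => M.indepOracle S = true)
          omega
        · exact (card_exchangeSet_image_le B c).trans (card_sq_le_searchLength _ _ _ (by omega)))
      (Fintype.card E) id
    simp only [decide_eq_true_eq]
    refine h.trans ?_
    -- With `k ≤ n` the bound is at most `8^(-n)/2 - 16^(-n)` plus a constant below `8/7 - 16/15 =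
    -- 8/105`, well under `1/3`.
    have h2 := pow_le_pow_right₀ (one_le_two : (1 : ℝ) ≤ 2) (numColors_le_card (id : E → E))
    set n := Fintype.card E
    have hn : 1 ≤ n := Fintype.card_pos
    have e : ((1 : ℝ) / 8) ^ n = 2 ^ n * (1 / 16) ^ n := by
      rw [← mul_pow]
      norm_num
    have h3 : ((1 : ℝ) / 8) ^ n ≤ 1 / 8 := pow_le_of_le_one (by norm_num) (by norm_num) (by omega)
    have h4 : (0 : ℝ) < (1 / 16) ^ n := by positivity
    have h5 : ((1 : ℝ) / 16) ^ n ≤ (1 / 8) ^ n := by gcongr; norm_num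
    have h6 := mul_le_mul_of_nonneg_right h2 h4.le
    rw [← e] at h6
    nlinarith
  · simp only [Matroid.IsConnected, not_forall, not_lt] at hM
    obtain ⟨X, hX, hXE, hsep⟩ := hM
    -- Singletons respect the separator `X` and every round preserves this, whereas a single colour
    -- would contradict it: rejection is certain.
    have hfix : ∀ m c, R m c M.indepOracle
        (fun c => if ∀ u v, c u = c v → (u ∈ X ↔ v ∈ X) then 0 else 1) ≤
          if ∀ u v, c u = c v → (u ∈ X ↔ v ∈ X) then 0 else 1 := fun m c => by
      refine round_separator_le (hR m c) (hsupp m c _) fun p hp hpx => ?_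
      refine hB.mem_iff_mem_of_eRk_add_eRk_le hXE.subset hsep (hE ▸ Set.mem_univ _)
        (Finset.mem_filter.1 hp).2.2.1 ?_
      exact (indepOracle_exchangeSet M B p).1 hpx
    have h1 := runRounds_le_self hR hfix
      (phases (searchLength (Fintype.card E)) (Fintype.card E)) id
    rw [if_pos fun u v h => by rw [show u = v from h]] at h1
    refine (hrun.mono _ fun c => ?_).trans h1
    simp only [decide_eq_true_eq]
    by_cases hc : ∀ u v, c u = c v → (u ∈ X ↔ v ∈ X)
    · rw [if_pos hc, if_neg]
      intro h
      obtain ⟨u, hu⟩ := hX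
      obtain ⟨v, -, hv⟩ := Set.exists_of_ssubset hXE
      refine hv ((hc u v ?_).1 hu)
      exact Finset.card_le_one.1 h _ (Finset.mem_image_of_mem c (Finset.mem_univ u)) _
        (Finset.mem_image_of_mem c (Finset.mem_univ v))
    · rw [if_neg hc]
      split_ifs <;> norm_num

/-- A realizable decision with one-sided expectations is made by a quantum decision tree. -/
theorem QuantumDecisionTree.Realizable.exists_prob {I : Type*} [Fintype I] [DecidableEq I] {T : ℕ}
    {R : (I → Bool) → (Bool → ℝ) → ℝ} (hR : Realizable T R) :
    ∃ A : QuantumDecisionTree I, A.T = T ∧ ∀ x,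
      (R x (fun y => if y = true then 0 else 1) ≤ 1 / 3 → 2 / 3 ≤ A.prob x true) ∧
      (R x (fun y => if y = true then 1 else 0) ≤ 0 → 2 / 3 ≤ A.prob x false) := by
  obtain ⟨A, out, hT, hA⟩ := id hR
  let A' : QuantumDecisionTree I := { A with out := out }
  have hs : ∀ x k, A'.state x k = A.state x k := fun x k =>
    (state_eq_evolve A' x k).trans (state_eq_evolve A x k).symm
  have hp : ∀ x b, A'.prob x b = R x fun o => if o = b then 1 else 0 := fun x b => by
    rw [prob_eq_expect, ← hA, expect, expect, hs]
  refine ⟨A', hT, fun x => ⟨fun h => ?_, fun h => ?_⟩⟩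
  · have e : (fun o : Bool => if o = true then (1 : ℝ) else 0) =
        fun o => -1 * (if o = true then 0 else 1) + 1 := by
      ext o
      cases o <;> simp
    rw [hp, e, hR.mul_add_const]
    linarith
  · have e : (fun o : Bool => if o = false then (1 : ℝ) else 0) =
        fun o => -1 * (if o = true then 1 else 0) + 1 := by
      ext o
      cases o <;> simp
    rw [hp, e, hR.mul_add_const]
    linarith

end connectivity

theorem mainTheorem2 :
    ∃ C : ℝ, ∀ (E : Type*) [Fintype E] [DecidableEq E],
      ∃ A : QuantumDecisionTree (Finset E),
        (A.T : ℝ) ≤ C * (Fintype.card E : ℝ) ^ (3 / 2 : ℝ) ∧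
        ∀ M : Matroid E, M.E = Set.univ →
          (M.IsConnected → 2 / 3 ≤ A.prob M.indepOracle true) ∧
          (¬ M.IsConnected → 2 / 3 ≤ A.prob M.indepOracle false) := by
  refine ⟨127, fun E _ _ => ?_⟩
  -- On the empty ground set the bound is `0` queries; connectedness is vacuous, so the answer is
  -- always YES.
  rcases isEmpty_or_nonempty E with hE | hE
  · obtain ⟨A, hT, hA⟩ := (QuantumDecisionTree.Realizable.idle (I := Finset E) 0 true).exists_prob
    refine ⟨A, by rw [hT, Nat.cast_zero]; positivity, fun M _ =>
      ⟨fun _ => (hA _).1 (by norm_num), fun h => absurd (fun X hX => ?_) h⟩⟩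
    exact isEmptyElim hX.some
  · choose R hR hdec using exists_realizable_isConnected (E := E)
    obtain ⟨A, hT, hA⟩ := ((realizable_greedyBase Finset.univ.toList ∅).bind hR).exists_prob
    refine ⟨A, ?_, fun M hM => ?_⟩
    · rw [hT, Finset.length_toList, Finset.card_univ]
      exact card_add_sum_searchLength_le _
    · have h := hdec _ M hM (isBase_greedyBase M)
      exact ⟨fun hc => (hA _).1 (h.1 hc), fun hc => (hA _).2 (h.2 hc)⟩
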